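/- Let $X$ be a collectionwise normal Hausdorff space, i.e. for every discrete collection $\mathscr{D}$ of subsets of $X$ there are open sets $U_D\supset D$, $D\in\mathscr{D}$, such that the indexed family $\{U_D:D\in\mathscr{D}\}$ is discrete (a family is discrete if every point of $X$ has a neighbourhood meeting at most one of its members). Let $E$ be a real Hilbert space, and let $\Phi$ assign to every $x\in X$ a nonempty closed convex subset $\Phi(x)$ of $E$. Suppose that $\Phi$ is lower semi-continuous, i.e. $\{x\in X:\Phi(x)\cap U\neq\emptyset\}$ is open in $X$ for every open $U\subset E$. If for some $\varepsilon>0$ there is a continuous map $g:X\to E$ such that every $g(x)$, $x\in X$, lies in the open $\varepsilon$-neighbourhood $\bigcup_{p\in\Phi(x)}\{y\in E:\|y-p\|<\varepsilon\}$ of $\Phi(x)$, then $\Phi$ has a continuous selection, i.e. there is a continuous map $f:X\to E$ such that $f(x)\in\Phi(x)$ for every $x\in X$. -/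

import Mathlib

open Topology

/-- An indexed family of subsets of a space is discrete if every point has a neighbourhood
meeting at most one member of the family. -/
def IsDiscreteFamily {X ι : Type*} [TopologicalSpace X] (D : ι → Set X) : Prop :=
  ∀ x : X, ∃ V ∈ 𝓝 x, {i : ι | (D i ∩ V).Nonempty}.Subsingleton

/-- A space is collectionwise normal if every discrete collection `𝒟` of subsets has an open
discrete expansion: open sets `U D ⊇ D`, for `D ∈ 𝒟`, forming a discrete family. -/
def IsCollectionwiseNormal (X : Type*) [TopologicalSpace X] : Prop :=
  ∀ 𝒟 : Set (Set X), IsDiscreteFamily (fun D : 𝒟 => (D : Set X)) →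
    ∃ U : 𝒟 → Set X, (∀ D, IsOpen (U D)) ∧ IsDiscreteFamily U ∧ ∀ D : 𝒟, (D : Set X) ⊆ U D

/-- The collection of all nonempty closed convex subsets of a real normed space. -/
def closedConvexSets (E : Type*) [NormedAddCommGroup E] [NormedSpace ℝ E] : Set (Set E) :=
  {S | S.Nonempty ∧ IsClosed S ∧ Convex ℝ S}

/-- `f` is a selection for the set-valued mapping `Φ`. -/
def IsSelection {X Y : Type*} (f : X → Y) (Φ : X → Set Y) : Prop :=
  ∀ x, f x ∈ Φ x

/-- `f` is an `ε`-selection for `Φ`: each `f x` lies in the open `ε`-neighbourhood of `Φ x`,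
i.e. in the union of the open `ε`-balls centred at the points of `Φ x`. -/
def IsEpsSelection {X Y : Type*} [PseudoMetricSpace Y] (ε : ℝ) (f : X → Y) (Φ : X → Set Y) :
    Prop :=
  ∀ x, f x ∈ Metric.thickening ε (Φ x)

/-!
The selection is the uniform limit of approximate selections, each improving the previous one by
the factor `99 / 100`: given a continuous `r`-selection `g`, a `99 / 100 * r`-selection is sought
whose values stay within `2 * r` of those of `g`.

Let `F` be the closed set where `g` itself is not good enough. By the parallelogram law, for `x ∈ F`
the part of `Φ x` in the ball of radius `r` about `g x` has small diameter: the midpoint of two of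
its points lies in the convex set `Φ x`, hence far from `g x`. So this part is contained in a small
neighbourhood of an `ℓ¹`-ball of a Hilbert basis as soon as it meets a smaller one, and `F` is
exhausted by closed sets over which `Φ` comes near a fixed `ℓ¹`-ball.

Rounding coordinates with respect to the basis discretizes such a neighbourhood: by Bessel's
inequality the rounding map takes boundedly many values on small balls, while duality between
`ℓ¹` and `ℓ^∞` shows that points with equal rounded coordinates are close. Selections of sets of
small diameter oscillate little even when discontinuous, so the discretization turns them into
families of bounded local multiplicity. Collectionwise normality expands these to locally finite
open families, and partitions of unity give continuous approximations, which are glued along the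
exhaustion of `F` and to `g`.
-/

open Set Filter Metric

section CollectionwiseNormal

variable {X J : Type*} [TopologicalSpace X]

theorem IsDiscreteFamily.eq_of_mem {A : J → Set X} (hA : IsDiscreteFamily A) {i j : J} {x : X}
    (hi : x ∈ A i) (hj : x ∈ A j) : i = j := by
  obtain ⟨V, hV, hAV⟩ := hA x
  exact hAV ⟨x, hi, mem_of_mem_nhds hV⟩ ⟨x, hj, mem_of_mem_nhds hV⟩

theorem IsCollectionwiseNormal.exists_isOpen_expansion (hX : IsCollectionwiseNormal X)
    {A : J → Set X} (hA : IsDiscreteFamily A) :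
    ∃ U : J → Set X, (∀ j, IsOpen (U j)) ∧ IsDiscreteFamily U ∧ ∀ j, A j ⊆ U j := by
  obtain ⟨U, hU_open, hU_discrete, hAU⟩ := hX (range A) fun x => by
    obtain ⟨V, hV, hAV⟩ := hA x
    refine ⟨V, hV, ?_⟩
    rintro ⟨_, i, rfl⟩ hi ⟨_, j, rfl⟩ hj
    exact Subtype.ext (congrArg A (hAV hi hj))
  -- The empty members of `A` may coincide, so they must be given empty neighbourhoods.
  refine ⟨fun j => {x ∈ U ⟨A j, j, rfl⟩ | (A j).Nonempty}, fun j => (hU_open _).inter isOpen_const,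
    fun x => ?_, fun j x hx => ⟨hAU ⟨A j, j, rfl⟩ hx, x, hx⟩⟩
  obtain ⟨V, hV, hUV⟩ := hU_discrete x
  refine ⟨V, hV, ?_⟩
  rintro i ⟨y, ⟨hy, a, ha⟩, hyV⟩ j ⟨z, ⟨hz, -⟩, hzV⟩
  have hij : A i = A j := congrArg Subtype.val (@hUV ⟨A i, i, rfl⟩ ⟨y, hy, hyV⟩ ⟨A j, j, rfl⟩
    ⟨z, hz, hzV⟩)
  exact hA.eq_of_mem ha (hij ▸ ha)

theorem IsCollectionwiseNormal.normalSpace (hX : IsCollectionwiseNormal X) : NormalSpace X := by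
  refine ⟨fun s t hs ht hst => ?_⟩
  obtain ⟨U, hU_open, hU_discrete, hU⟩ :=
    hX.exists_isOpen_expansion (A := fun b : Bool => if b then s else t) fun x => by
      by_cases hx : x ∈ s
      · refine ⟨tᶜ, ht.isOpen_compl.mem_nhds (disjoint_left.1 hst hx), ?_⟩
        rintro (_ | _) ⟨y, hy, hy'⟩ (_ | _) ⟨z, hz, hz'⟩ <;> simp_all
      · refine ⟨sᶜ, hs.isOpen_compl.mem_nhds hx, ?_⟩
        rintro (_ | _) ⟨y, hy, hy'⟩ (_ | _) ⟨z, hz, hz'⟩ <;> simp_all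
  exact ⟨U true, U false, hU_open _, hU_open _, by simpa using hU true, by simpa using hU false,
    disjoint_left.2 fun x hx hx' => Bool.noConfusion (hU_discrete.eq_of_mem hx hx')⟩

theorem isDiscreteFamily_setOf_forall_mem {A : J → Set X} (hA_closed : ∀ j, IsClosed (A j))
    (hA : LocallyFinite A) {n : ℕ} (hn : ∀ x, {j | x ∈ A j}.encard ≤ n) :
    IsDiscreteFamily fun s : {s : Set J // s.encard = n} => {x | ∀ j ∈ s.1, x ∈ A j} := by
  intro x
  have hs_eq : ∀ s : {s : Set J // s.encard = n},
      ({x | ∀ j ∈ s.1, x ∈ A j} ∩ {y | {j | y ∈ A j} ⊆ {j | x ∈ A j}}).Nonempty →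
        s.1 = {j | x ∈ A j} := by
    rintro ⟨s, hs⟩ ⟨y, hsy, hyx⟩
    exact (finite_of_encard_eq_coe hs).eq_of_subset_of_encard_le (fun j hj => hyx (hsy j hj))
      (hs ▸ hn x)
  exact ⟨_, hA.eventually_subset hA_closed x,
    fun s hs t ht => Subtype.ext ((hs_eq s hs).trans (hs_eq t ht).symm)⟩

theorem IsCollectionwiseNormal.exists_locallyFinite_encard_le (hX : IsCollectionwiseNormal X)
    {A : J → Set X} (hA_closed : ∀ j, IsClosed (A j)) (hA : LocallyFinite A) {n : ℕ}
    (hn : ∀ x, {j | x ∈ A j}.encard ≤ (n + 1 : ℕ)) :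
    ∃ W : J → Set X, (∀ j, IsOpen (W j)) ∧ LocallyFinite W ∧
      ∀ x, {j | x ∈ A j \ W j}.encard ≤ n := by
  obtain ⟨U, hU_open, hU_discrete, hU⟩ :=
    hX.exists_isOpen_expansion (isDiscreteFamily_setOf_forall_mem hA_closed hA hn)
  refine ⟨fun j => ⋃ (s) (_ : j ∈ s.1), U s, fun j => isOpen_biUnion fun s _ => hU_open s,
    fun x => ?_, fun x => ?_⟩
  · obtain ⟨V, hV, hUV⟩ := hU_discrete x
    refine ⟨V, hV, (hUV.finite.biUnion fun s _ => finite_of_encard_eq_coe s.2).subset ?_⟩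
    rintro j ⟨y, hy, hyV⟩
    obtain ⟨s, hjs, hys⟩ := mem_iUnion₂.1 hy
    exact mem_biUnion (show s ∈ _ from ⟨y, hys, hyV⟩) hjs
  · rcases (hn x).lt_or_eq with hlt | heq
    · refine (encard_le_encard fun j hj => hj.1).trans ?_
      exact Order.le_of_lt_add_one (by exact_mod_cast hlt)
    · have hempty : {j | x ∈ A j \ ⋃ (s) (_ : j ∈ s.1), U s} = ∅ :=
        eq_empty_of_forall_notMem fun j hj =>
          hj.2 (mem_iUnion₂.2 ⟨⟨_, heq⟩, hj.1, hU ⟨_, heq⟩ fun _ => id⟩)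
      simp only [hempty, encard_empty, zero_le]

theorem IsCollectionwiseNormal.exists_locallyFinite_expansion (hX : IsCollectionwiseNormal X)
    {A : J → Set X} (hA_closed : ∀ j, IsClosed (A j)) (hA : LocallyFinite A) {n : ℕ}
    (hn : ∀ x, {j | x ∈ A j}.encard ≤ n) :
    ∃ U : J → Set X, (∀ j, IsOpen (U j)) ∧ LocallyFinite U ∧ ∀ j, A j ⊆ U j := by
  induction n generalizing A with
  | zero =>
    refine ⟨fun _ => ∅, fun _ => isOpen_empty, fun x => ⟨univ, univ_mem, by simp⟩,
      fun j x hx => ?_⟩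
    have hx_empty : {j | x ∈ A j} = ∅ := by simpa using hn x
    exact hx_empty.subset hx
  | succ n ih =>
    obtain ⟨W, hW_open, hW, hAW⟩ := hX.exists_locallyFinite_encard_le hA_closed hA hn
    obtain ⟨U, hU_open, hU, hAU⟩ := ih (fun j => (hA_closed j).sdiff (hW_open j))
      (hA.subset fun j => sdiff_subset) hAW
    refine ⟨fun j => W j ∪ U j, fun j => (hW_open j).union (hU_open j), fun x => ?_,
      fun j => sdiff_subset_iff.1 (hAU j)⟩
    obtain ⟨V, hV, hWV⟩ := hW x
    obtain ⟨V', hV', hUV'⟩ := hU x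
    refine ⟨V ∩ V', inter_mem hV hV', (hWV.union hUV').subset ?_⟩
    rintro j ⟨y, hy | hy, hyV, hyV'⟩
    exacts [Or.inl ⟨y, hy, hyV⟩, Or.inr ⟨y, hy, hyV'⟩]

theorem IsCollectionwiseNormal.exists_locallyFinite_expansion_of_encard_le
    (hX : IsCollectionwiseNormal X) {A : J → Set X} {n : ℕ}
    (hn : ∀ x, ∃ V ∈ 𝓝 x, {j | (A j ∩ V).Nonempty}.encard ≤ n) :
    ∃ U : J → Set X, (∀ j, IsOpen (U j)) ∧ LocallyFinite U ∧ ∀ j, A j ⊆ U j := by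
  have hA : LocallyFinite A := fun x => by
    obtain ⟨V, hV, hAV⟩ := hn x
    exact ⟨V, hV, finite_of_encard_le_coe hAV⟩
  have hA_closure : ∀ x, {j | x ∈ closure (A j)}.encard ≤ n := fun x => by
    obtain ⟨V, hV, hAV⟩ := hn x
    refine (encard_le_encard fun j hj => ?_).trans hAV
    rw [mem_ofPred_eq, inter_comm]
    exact mem_closure_iff_nhds.1 hj V hV
  obtain ⟨U, hU_open, hU, hAU⟩ :=
    hX.exists_locallyFinite_expansion (fun _ => isClosed_closure) hA.closure hA_closure
  exact ⟨U, hU_open, hU, fun j => subset_closure.trans (hAU j)⟩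

end CollectionwiseNormal

section Gluing

variable {X E : Type*} [TopologicalSpace X] [AddCommGroup E] [Module ℝ E] [TopologicalSpace E]
  [ContinuousAdd E] [ContinuousSMul ℝ E]

theorem exists_continuous_eqOn_mem [NormalSpace X] {K : X → Set E}
    (hK : ∀ x, Convex ℝ (K x)) {F V : Set X} (hF : IsClosed F) (hV : IsOpen V) (hFV : F ⊆ V)
    {g v : X → E} (hg : Continuous g) (hv : ContinuousOn v V) (hvK : ∀ x ∈ V, v x ∈ K x) :
    ∃ h : X → E, Continuous h ∧ EqOn h v F ∧ ∀ x, (x ∉ F → g x ∈ K x) → h x ∈ K x := by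
  obtain ⟨P, hP, hFP, hPV⟩ := normal_exists_closure_subset hF hV hFV
  obtain ⟨u, hu_zero, hu_one, hu⟩ := exists_continuous_zero_one_of_isClosed hP.isClosed_compl hF
    (disjoint_compl_left_iff_subset.2 hFP)
  let h : X → E := fun x => (1 - u x) • g x + u x • v x
  have h_eq_g : EqOn h g (closure P)ᶜ := fun x hx => by
    simp [h, hu_zero (fun hxP => hx (subset_closure hxP))]
  have h_eq_v : EqOn h v F := fun x hx => by simp [h, hu_one hx]
  refine ⟨h, ?_, h_eq_v, fun x hgx => ?_⟩
  · have hhV : ContinuousOn h V := by fun_prop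
    have hh_compl : ContinuousOn h (closure P)ᶜ := hg.continuousOn.congr h_eq_g
    have hcover : V ∪ (closure P)ᶜ = univ := by
      rw [union_comm, ← compl_subset_iff_union, compl_compl]; exact hPV
    rw [← continuousOn_univ, ← hcover]
    exact hhV.union_of_isOpen hh_compl hV isClosed_closure.isOpen_compl
  · by_cases hxF : x ∈ F
    · exact h_eq_v hxF ▸ hvK x (hFV hxF)
    by_cases hxV : x ∈ V
    · exact hK x (hgx hxF) (hvK x hxV) (sub_nonneg.2 (hu x).2) (hu x).1 (sub_add_cancel _ _)
    · exact (h_eq_g fun hx => hxV (hPV hx)) ▸ hgx hxF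

theorem exists_continuousOn_iUnion_mem [NormalSpace X] {K : X → Set E} (hK_graph : HasOpenCGraph K)
    (hK : ∀ x, Convex ℝ (K x)) {Q : ℕ → Set X} (hQ_closed : ∀ n, IsClosed (Q n))
    (hQ_mono : Monotone Q)
    (hQ_sel : ∀ n, ∃ g : X → E, Continuous g ∧ ∀ x ∈ Q n, g x ∈ K x) :
    ∃ h : X → E, ContinuousOn h (⋃ n, interior (Q n)) ∧ ∀ x ∈ ⋃ n, Q n, h x ∈ K x := by
  have hstep : ∀ n (h : {h : X → E // Continuous h ∧ ∀ x ∈ Q n, h x ∈ K x}),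
      ∃ h' : {h' : X → E // Continuous h' ∧ ∀ x ∈ Q (n + 1), h' x ∈ K x},
        EqOn h'.1 h.1 (Q n) := by
    rintro n ⟨h, hh, hhK⟩
    obtain ⟨g, hg, hgK⟩ := hQ_sel (n + 1)
    obtain ⟨h', hh', heq, hh'K⟩ := exists_continuous_eqOn_mem hK (hQ_closed n)
      (hK_graph.preimage (continuous_id.prodMk hh)) hhK hg hh.continuousOn fun x hx => hx
    exact ⟨⟨h', hh', fun x hx => hh'K x fun _ => hgK x hx⟩, heq⟩
  choose next hnext using hstep
  choose h₀ hh₀ using hQ_sel 0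
  let h : ∀ n, {h : X → E // Continuous h ∧ ∀ x ∈ Q n, h x ∈ K x} := Nat.rec ⟨h₀, hh₀⟩ next
  have h_eqOn : ∀ {m n}, m ≤ n → EqOn (h n).1 (h m).1 (Q m) := fun hmn =>
    Nat.le_induction (fun _ _ => rfl)
      (fun n hmn ih => ((hnext n (h n)).mono (hQ_mono hmn)).trans ih) _ hmn
  choose! N hN using fun x (hx : x ∈ ⋃ n, Q n) => mem_iUnion.1 hx
  have h_eq : ∀ n, EqOn (fun x => (h (N x)).1 x) (h n).1 (Q n) := fun n x hx =>
    (le_total n (N x)).elim (fun hn => h_eqOn hn hx)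
      fun hn => (h_eqOn hn (hN x (mem_iUnion_of_mem n hx))).symm
  refine ⟨fun x => (h (N x)).1 x, fun x hx => ?_, fun x hx => (h (N x)).2.2 x (hN x hx)⟩
  obtain ⟨n, hn⟩ := mem_iUnion.1 hx
  exact ((h n).2.1.continuousAt.congr (((h_eq n).eventuallyEq_of_mem
    (mem_interior_iff_mem_nhds.1 hn)).symm)).continuousWithinAt

end Gluing

section LowerHemicontinuous

variable {X E : Type*} [TopologicalSpace X] [PseudoMetricSpace E]

theorem hasOpenCGraph_ball {g : X → E} (hg : Continuous g) (r : ℝ) :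
    HasOpenCGraph fun x => ball (g x) r :=
  isOpen_lt (continuous_snd.dist (hg.comp continuous_fst)) continuous_const

theorem hasOpenCGraph_thickening {Φ : X → Set E} (hΦ : LowerHemicontinuous Φ) (r : ℝ) :
    HasOpenCGraph fun x => thickening r (Φ x) := by
  have hfst : LowerHemicontinuous fun z : X × E => Φ z.1 := hΦ.comp continuous_fst
  have hopen := lowerHemicontinuous_iff_isOpen_inter_nonempty.1
    (hfst.inter_hasOpenCGraph (hasOpenCGraph_ball continuous_snd r)) univ isOpen_univ
  convert hopen using 1
  ext ⟨x, y⟩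
  simp only [mem_ofPred_eq, inter_univ, mem_thickening_iff, Set.Nonempty, mem_inter_iff, mem_ball,
    dist_comm]

theorem isOpen_setOf_mem_thickening {Φ : X → Set E} (hΦ : LowerHemicontinuous Φ) {g : X → E}
    (hg : Continuous g) (r : ℝ) : IsOpen {x | g x ∈ thickening r (Φ x)} :=
  (hasOpenCGraph_thickening hΦ r).preimage (continuous_id.prodMk hg)

end LowerHemicontinuous

section Discretization

variable {X E : Type*} [TopologicalSpace X]

/-- The oscillation of `p` along `F` is less than `θ` at every point of `F`. -/
def OscillationLT [PseudoMetricSpace E] (θ : ℝ) (p : X → E) (F : Set X) : Prop :=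
  ∀ x ∈ F, ∀ᶠ y in 𝓝 x, y ∈ F → dist (p y) (p x) < θ

/-- `T` can be discretized at scale `r`: some map `κ` displaces the points of `T` by at most `r`
and takes a uniformly bounded number of values on the trace of `T` on balls of a fixed radius.
This replaces total boundedness, which fails for the sets of interest here; the values of `κ` need
not lie in `T`. -/
def HasUniformDiscretization [PseudoMetricSpace E] (T : Set E) (r : ℝ) : Prop :=
  ∃ κ : E → E, (∀ y ∈ T, dist (κ y) y ≤ r) ∧
    ∃ θ > 0, ∃ n : ℕ, ∀ y ∈ T, (κ '' (T ∩ ball y θ)).encard ≤ n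

theorem IsCollectionwiseNormal.exists_continuous_dist_lt [SeminormedAddCommGroup E]
    [NormedSpace ℝ E] (hX : IsCollectionwiseNormal X) {T : Set E} {r R : ℝ}
    (hT : HasUniformDiscretization T r) (hrR : r < R) :
    ∃ θ > 0, ∀ {F : Set X} {p : X → E}, IsClosed F → OscillationLT θ p F → MapsTo p F T →
      ∃ v : X → E, Continuous v ∧ ∀ x ∈ F, dist (v x) (p x) < R := by
  have : NormalSpace X := hX.normalSpace
  obtain ⟨κ, hκ, θ, hθ, n, hn⟩ := hT
  refine ⟨min θ (R - r), lt_min hθ (sub_pos.2 hrR), fun {F p} hF hp hpT => ?_⟩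
  let B : E → Set X := fun e => {x ∈ F | κ (p x) = e}
  obtain ⟨G, hG_open, hG, hBG⟩ :=
    hX.exists_locallyFinite_expansion_of_encard_le (A := B) (n := n) fun x => by
      by_cases hxF : x ∈ F
      · refine ⟨_, hp x hxF, (encard_le_encard ?_).trans (hn (p x) (hpT hxF))⟩
        rintro _ ⟨y, ⟨hyF, rfl⟩, hy⟩
        exact ⟨p y, ⟨hpT hyF, (hy hyF).trans_le (min_le_left _ _)⟩, rfl⟩
      · refine ⟨Fᶜ, hF.isOpen_compl.mem_nhds hxF, ?_⟩
        have hempty : {e | (B e ∩ Fᶜ).Nonempty} = ∅ :=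
          eq_empty_of_forall_notMem fun e ⟨y, hy, hyF⟩ => hyF hy.1
        simp only [hempty, encard_empty, zero_le]
  let U : E → Set X := fun e => G e ∩ interior {x | x ∈ F → e ∈ ball (p x) R}
  have hFU : F ⊆ ⋃ e, U e := fun x hxF => mem_iUnion.2 ⟨κ (p x), hBG _ ⟨hxF, rfl⟩,
    mem_interior_iff_mem_nhds.2 <| (hp x hxF).mono fun y hy hyF => by
      have hpy := (hy hyF).trans_le (min_le_right _ _)
      have hpx := hκ (p x) (hpT hxF)
      rw [dist_comm] at hpy
      exact mem_ball.2 ((dist_triangle _ (p x) _).trans_lt (by linarith))⟩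
  have hU_open : ∀ e, IsOpen (U e) := fun e => (hG_open e).inter isOpen_interior
  obtain ⟨f, hf⟩ := PartitionOfUnity.exists_isSubordinate_of_locallyFinite hF U hU_open
    (hG.subset fun e => inter_subset_left) hFU
  refine ⟨fun x => ∑ᶠ e, f e x • e,
    hf.continuous_finsum_smul hU_open fun e => continuousOn_const, fun x hxF => ?_⟩
  refine f.finsum_smul_mem_convex (g := fun e _ => e) (t := ball (p x) R) hxF (fun e he => ?_)
    (convex_ball _ _)
  exact interior_subset (hf e (subset_closure he)).2 hxF

end Discretization

section L1Ball

open scoped InnerProductSpace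

variable {ι E : Type*} [NormedAddCommGroup E] [InnerProductSpace ℝ E]

/-- The `ℓ¹`-ball of radius `n` with respect to the family `b`: the vectors whose coordinates
`⟪b i, y⟫` are absolutely summable with sum at most `n`. -/
def l1Ball (b : ι → E) (n : ℝ) : Set E :=
  {y | ∀ s : Finset ι, ∑ i ∈ s, |⟪b i, y⟫_ℝ| ≤ n}

theorem l1Ball_mono (b : ι → E) : Monotone (l1Ball b) := fun _ _ hmn _ hy s => (hy s).trans hmn

theorem convex_l1Ball (b : ι → E) (n : ℝ) : Convex ℝ (l1Ball b n) := by
  intro y hy z hz u v hu hv huv s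
  calc ∑ i ∈ s, |⟪b i, u • y + v • z⟫_ℝ|
      ≤ ∑ i ∈ s, (u * |⟪b i, y⟫_ℝ| + v * |⟪b i, z⟫_ℝ|) := Finset.sum_le_sum fun i _ => by
        simpa only [inner_add_right, inner_smul_right, abs_mul, abs_of_nonneg hu, abs_of_nonneg hv]
          using abs_add_le (u * ⟪b i, y⟫_ℝ) (v * ⟪b i, z⟫_ℝ)
    _ = u * ∑ i ∈ s, |⟪b i, y⟫_ℝ| + v * ∑ i ∈ s, |⟪b i, z⟫_ℝ| := by
        rw [Finset.sum_add_distrib, Finset.mul_sum, Finset.mul_sum]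
    _ ≤ u * n + v * n := by gcongr; exacts [hy s, hz s]
    _ = n := by rw [← add_mul, huv, one_mul]

theorem sum_smul_mem_l1Ball {b : ι → E} (hb : Orthonormal ℝ b) (s : Finset ι) (c : ι → ℝ) :
    ∑ i ∈ s, c i • b i ∈ l1Ball b (∑ i ∈ s, |c i|) := by
  classical
  intro t
  have hcoord : ∀ i, |⟪b i, ∑ j ∈ s, c j • b j⟫_ℝ| = if i ∈ s then |c i| else 0 := fun i => by
    simp only [inner_sum, inner_smul_right, orthonormal_iff_ite.1 hb, mul_ite, mul_one, mul_zero,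
      Finset.sum_ite_eq]
    split_ifs <;> simp only [abs_zero]
  calc ∑ i ∈ t, |⟪b i, ∑ j ∈ s, c j • b j⟫_ℝ| = ∑ i ∈ t with i ∈ s, |c i| := by
        simp only [hcoord, Finset.sum_filter]
    _ ≤ ∑ i ∈ s, |c i| :=
        Finset.sum_le_sum_of_subset_of_nonneg (fun i hi => (Finset.mem_filter.1 hi).2)
          fun _ _ _ => abs_nonneg _

theorem exists_nat_mem_thickening_l1Ball (b : HilbertBasis ι ℝ E) (y : E) {ε : ℝ} (hε : 0 < ε) :
    ∃ n : ℕ, y ∈ thickening ε (l1Ball b n) := by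
  obtain ⟨s, hs⟩ := ((b.hasSum_repr y).eventually (ball_mem_nhds y hε)).exists
  obtain ⟨n, hn⟩ := exists_nat_ge (∑ i ∈ s, |b.repr y i|)
  exact ⟨n, mem_thickening_iff.2
    ⟨_, l1Ball_mono b hn (sum_smul_mem_l1Ball b.orthonormal s (b.repr y)), mem_ball'.1 hs⟩⟩

theorem inner_le_of_mem_l1Ball (b : HilbertBasis ι ℝ E) {w y : E} {τ n : ℝ} (hτ : 0 ≤ τ)
    (hw : ∀ i, |⟪w, b i⟫_ℝ| ≤ τ) (hy : y ∈ l1Ball b n) : ⟪w, y⟫_ℝ ≤ τ * n := by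
  refine hasSum_le_of_sum_le (b.hasSum_inner_mul_inner w y) fun s => ?_
  calc ∑ i ∈ s, ⟪w, b i⟫_ℝ * ⟪b i, y⟫_ℝ
      ≤ ∑ i ∈ s, τ * |⟪b i, y⟫_ℝ| := Finset.sum_le_sum fun i _ => by
        grw [le_abs_self (_ * _), abs_mul, hw i]
    _ ≤ τ * n := by grw [← Finset.mul_sum, hy s]

theorem norm_le_of_mem_l1Ball (b : HilbertBasis ι ℝ E) {y : E} {n : ℝ} (hy : y ∈ l1Ball b n) :
    ‖y‖ ≤ n := by
  have hn : 0 ≤ n := hy ∅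
  have hcoord : ∀ i, |⟪y, b i⟫_ℝ| ≤ ‖y‖ := fun i => by
    simpa only [b.orthonormal.norm_eq_one, mul_one] using abs_real_inner_le_norm y (b i)
  have hsq := inner_le_of_mem_l1Ball b (norm_nonneg y) hcoord hy
  rw [real_inner_self_eq_norm_mul_norm] at hsq
  rcases (norm_nonneg y).eq_or_lt with hy_zero | hy_pos
  exacts [hy_zero ▸ hn, le_of_mul_le_mul_left hsq hy_pos]

end L1Ball

section Rounding

open scoped InnerProductSpace

variable {ι E : Type*} [NormedAddCommGroup E] [InnerProductSpace ℝ E]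

theorem encard_setOf_le_abs_inner_le {b : ι → E} (hb : Orthonormal ℝ b) {ε M : ℝ} (hε : 0 < ε)
    {y : E} (hy : ‖y‖ ≤ M) : {i | ε ≤ |⟪b i, y⟫_ℝ|}.encard ≤ ⌊(M / ε) ^ 2⌋₊ := by
  by_contra! hlt
  obtain ⟨t, ht, htcard⟩ := exists_subset_encard_eq (Order.add_one_le_of_lt hlt)
  lift t to Finset ι using finite_of_encard_eq_coe htcard
  have hcard : t.card = ⌊(M / ε) ^ 2⌋₊ + 1 := by
    rw [encard_coe_eq_coe_finsetCard] at htcard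
    exact_mod_cast htcard
  have hbessel : t.card * ε ^ 2 ≤ M ^ 2 :=
    calc t.card * ε ^ 2 = ∑ i ∈ t, ε ^ 2 := by rw [Finset.sum_const, nsmul_eq_mul]
      _ ≤ ∑ i ∈ t, ‖⟪b i, y⟫_ℝ‖ ^ 2 := by gcongr with i hi; exact ht hi
      _ ≤ ‖y‖ ^ 2 := hb.sum_inner_products_le y
      _ ≤ M ^ 2 := by gcongr
  have hle : (t.card : ℝ) ≤ (M / ε) ^ 2 := by rwa [div_pow, le_div_iff₀ (by positivity)]
  exact absurd (Nat.le_floor hle) (by lia)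

theorem encard_setOf_forall_abs_sub_le_one {s : Set ι} {k : ℕ} (hs : s.encard ≤ k) (m : ι → ℤ) :
    {c : ι → ℤ | (∀ i ∈ s, |c i - m i| ≤ 1) ∧ ∀ i ∉ s, c i = 0}.encard ≤ (3 ^ k : ℕ) := by
  have : Fintype s := (finite_of_encard_le_coe hs).fintype
  have hIcc : ∀ i, (Icc (m i - 1) (m i + 1)).encard = 3 := fun i => by
    rw [← Finset.coe_Icc, encard_coe_eq_coe_finsetCard, Int.card_Icc,
      show m i + 1 + 1 - (m i - 1) = 3 by ring]
    rfl
  calc _ ≤ (pi univ fun i : s => Icc (m i - 1) (m i + 1)).encard :=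
        encard_le_encard_of_injOn (f := fun c (i : s) => c i) (fun c hc i _ => ?_)
          fun c hc c' hc' heq => ?_
    _ = 3 ^ Fintype.card s := by
        simp only [encard_pi_eq_prod_encard, hIcc, Finset.prod_const, Finset.card_univ]
    _ ≤ (3 ^ k : ℕ) := ?_
  · obtain ⟨hl, hr⟩ := abs_le.1 (hc.1 i i.2)
    exact ⟨by lia, by lia⟩
  · funext i
    by_cases hi : i ∈ s
    exacts [congrFun heq ⟨i, hi⟩, (hc.2 i hi).trans (hc'.2 i hi).symm]
  · have hcard : Fintype.card s ≤ k := by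
      rw [← Set.coe_fintypeCard] at hs
      exact_mod_cast hs
    exact_mod_cast Nat.pow_le_pow_right (by norm_num) hcard

theorem abs_round_sub_round_le_one {x y : ℝ} (hxy : |x - y| < 1) :
    |round x - round y| ≤ 1 := by
  have hlt : |(round x - round y : ℝ)| < 2 := by
    obtain ⟨hxy_left, hxy_right⟩ := abs_lt.1 hxy
    obtain ⟨hx_left, hx_right⟩ := abs_le.1 (abs_sub_round x)
    obtain ⟨hy_left, hy_right⟩ := abs_le.1 (abs_sub_round y)
    exact abs_lt.2 ⟨by linarith, by linarith⟩
  exact Int.lt_add_one_iff.1 (by exact_mod_cast hlt)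

/-- The coordinates of `y` with respect to `b`, rounded to the nearest multiple of `δ` and
expressed in units of `δ`. -/
noncomputable def roundCoord (b : ι → E) (δ : ℝ) (y : E) (i : ι) : ℤ :=
  round (⟪b i, y⟫_ℝ / δ)

theorem abs_inner_sub_le_of_roundCoord_eq {b : ι → E} {δ : ℝ} (hδ : 0 < δ) {y z : E} {i : ι}
    (h : roundCoord b δ y i = roundCoord b δ z i) : |⟪b i, y - z⟫_ℝ| ≤ δ := by
  have hy : |⟪b i, y⟫_ℝ / δ - roundCoord b δ y i| ≤ 1 / 2 := abs_sub_round _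
  have hz : |⟪b i, z⟫_ℝ / δ - roundCoord b δ z i| ≤ 1 / 2 := abs_sub_round _
  have hdiv : |⟪b i, y - z⟫_ℝ| / δ ≤ 1 := by
    rw [h] at hy
    calc |⟪b i, y - z⟫_ℝ| / δ = |⟪b i, y⟫_ℝ / δ - ⟪b i, z⟫_ℝ / δ| := by
          rw [inner_sub_right, ← sub_div, abs_div, abs_of_pos hδ]
      _ ≤ |⟪b i, y⟫_ℝ / δ - roundCoord b δ z i| + |⟪b i, z⟫_ℝ / δ - roundCoord b δ z i| := by
          grw [abs_sub_le _ (roundCoord b δ z i : ℝ), abs_sub_comm (⟪b i, z⟫_ℝ / δ)]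
      _ ≤ 1 := by linarith
  simpa only [one_mul] using (div_le_iff₀ hδ).1 hdiv

theorem encard_image_roundCoord_ball_le {b : ι → E} (hb : Orthonormal ℝ b) {δ M : ℝ} (hδ : 0 < δ)
    {y : E} (hy : ‖y‖ ≤ M) :
    (roundCoord b δ '' ball y (δ / 4)).encard ≤ (3 ^ ⌊(M / (δ / 4)) ^ 2⌋₊ : ℕ) := by
  refine (encard_le_encard ?_).trans (encard_setOf_forall_abs_sub_le_one
    (encard_setOf_le_abs_inner_le hb (by positivity) hy) (roundCoord b δ y))
  rintro _ ⟨z, hz, rfl⟩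
  have hzy : ∀ i, |⟪b i, z⟫_ℝ / δ - ⟪b i, y⟫_ℝ / δ| < 1 / 4 := fun i => by
    have hinner : |⟪b i, z⟫_ℝ - ⟪b i, y⟫_ℝ| < δ / 4 := by
      rw [← inner_sub_right]
      refine (abs_real_inner_le_norm _ _).trans_lt ?_
      rwa [hb.norm_eq_one, one_mul, ← mem_ball_iff_norm]
    rw [← sub_div, abs_div, abs_of_pos hδ, div_lt_iff₀ hδ]
    linarith
  refine ⟨fun i _ => abs_round_sub_round_le_one ((hzy i).trans (by norm_num)), fun i hi => ?_⟩
  have hy_lt : |⟪b i, y⟫_ℝ / δ| < 1 / 4 := by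
    rw [abs_div, abs_of_pos hδ, div_lt_iff₀ hδ]
    exact (not_le.1 (show ¬δ / 4 ≤ _ from hi)).trans_eq (by ring)
  obtain ⟨hzy_left, hzy_right⟩ := abs_lt.1 (hzy i)
  obtain ⟨hy_left, hy_right⟩ := abs_lt.1 hy_lt
  exact round_eq_zero_iff.2 ⟨by linarith, by linarith⟩

end Rounding

section DiscretizationL1Ball

open scoped InnerProductSpace

variable {ι E : Type*} [NormedAddCommGroup E] [InnerProductSpace ℝ E]

theorem inner_le_of_mem_thickening_l1Ball (b : HilbertBasis ι ℝ E) {w y : E} {n β τ : ℝ}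
    (hτ : 0 ≤ τ) (hw : ∀ i, |⟪w, b i⟫_ℝ| ≤ τ) (hy : y ∈ thickening β (l1Ball b n)) :
    ⟪w, y⟫_ℝ ≤ β * ‖w‖ + τ * n := by
  obtain ⟨a, ha, hya⟩ := mem_thickening_iff.1 hy
  calc ⟪w, y⟫_ℝ = ⟪w, y - a⟫_ℝ + ⟪w, a⟫_ℝ := by rw [← inner_add_right, sub_add_cancel]
    _ ≤ ‖w‖ * β + τ * n := by
        grw [real_inner_le_norm, ← dist_eq_norm, hya.le, inner_le_of_mem_l1Ball b hτ hw ha]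
    _ = β * ‖w‖ + τ * n := by rw [mul_comm]

theorem dist_le_of_forall_roundCoord_eq (b : HilbertBasis ι ℝ E) {y z : E} {n β δ R : ℝ}
    (hδ : 0 < δ) (hβR : 2 * β < R) (hδR : 2 * n * δ ≤ R * (R - 2 * β))
    (hy : y ∈ thickening β (l1Ball b n)) (hz : z ∈ thickening β (l1Ball b n))
    (hyz : roundCoord b δ y = roundCoord b δ z) : dist y z ≤ R := by
  have hle : ∀ {y z}, roundCoord b δ y = roundCoord b δ z → ∀ i, |⟪y - z, b i⟫_ℝ| ≤ δ :=
    fun h i => real_inner_comm (b i) _ ▸ abs_inner_sub_le_of_roundCoord_eq hδ (congrFun h i)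
  have hy_inner := inner_le_of_mem_thickening_l1Ball b hδ.le (hle hyz) hy
  have hz_inner := inner_le_of_mem_thickening_l1Ball b hδ.le (hle hyz.symm) hz
  have hsq : ‖y - z‖ ^ 2 = ⟪y - z, y⟫_ℝ + ⟪z - y, z⟫_ℝ := by
    rw [← real_inner_self_eq_norm_sq, inner_sub_right, ← neg_sub z y, inner_neg_left,
      inner_neg_left]
    ring
  rw [norm_sub_rev z y] at hz_inner
  rw [dist_eq_norm]
  by_contra! hlt
  have hgap := mul_lt_mul_of_pos_right hlt (sub_pos.2 hβR)
  have hnorm := mul_le_mul_of_nonneg_left hlt.le (norm_nonneg (y - z))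
  linarith

theorem hasUniformDiscretization_thickening_l1Ball (b : HilbertBasis ι ℝ E) {n β R : ℝ}
    (hβ : 0 < β) (hβR : 2 * β < R) :
    HasUniformDiscretization (thickening β (l1Ball b n)) R := by
  set T := thickening β (l1Ball b n)
  have hc : 0 < R * (R - 2 * β) := mul_pos (by linarith) (by linarith)
  obtain ⟨δ, hδ, hδR⟩ := exists_pos_mul_lt hc (2 * n)
  have hT_norm : ∀ y ∈ T, ‖y‖ ≤ β + n := fun y hy => by
    obtain ⟨a, ha, hya⟩ := mem_thickening_iff.1 hy
    grw [← norm_le_of_mem_l1Ball b ha, ← hya, dist_eq_norm, ← norm_le_norm_sub_add y a]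
  refine ⟨fun y => Function.invFunOn (roundCoord b δ) T (roundCoord b δ y), fun y hy => ?_,
    δ / 4, by positivity, 3 ^ ⌊((β + n) / (δ / 4)) ^ 2⌋₊, fun y hy => ?_⟩
  · have hex : ∃ z ∈ T, roundCoord b δ z = roundCoord b δ y := ⟨y, hy, rfl⟩
    exact dist_le_of_forall_roundCoord_eq b hδ hβR hδR.le (Function.invFunOn_mem hex) hy
      (Function.invFunOn_eq hex)
  · rw [← Function.comp_def, image_comp]
    grw [encard_image_le, inter_subset_right]
    exact encard_image_roundCoord_ball_le b.orthonormal hδ (hT_norm y hy)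

end DiscretizationL1Ball

section Improvement

variable {X E : Type*} [TopologicalSpace X]

theorem oscillationLT_of_forall_dist_le [PseudoMetricSpace E] {K : X → Set E}
    (hK : LowerHemicontinuous K) {F : Set X} {p : X → E} {s θ : ℝ} (hp : ∀ x ∈ F, p x ∈ K x)
    (hdiam : ∀ x ∈ F, ∀ y ∈ K x, ∀ z ∈ K x, dist y z ≤ s) (hsθ : s < θ) :
    OscillationLT θ p F := fun x hx => by
  have hopen := lowerHemicontinuous_iff_isOpen_inter_nonempty.1 hK (ball (p x) (θ - s)) isOpen_ball
  have hx_mem : (K x ∩ ball (p x) (θ - s)).Nonempty :=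
    ⟨p x, hp x hx, mem_ball_self (sub_pos.2 hsθ)⟩
  filter_upwards [hopen.mem_nhds hx_mem] with y ⟨z, hz, hzx⟩ hy
  calc dist (p y) (p x) ≤ dist (p y) z + dist z (p x) := dist_triangle _ _ _
    _ < s + (θ - s) := add_lt_add_of_le_of_lt (hdiam y hy _ (hp y hy) _ hz) hzx
    _ = θ := add_sub_cancel _ _

variable [NormedAddCommGroup E] [InnerProductSpace ℝ E]

theorem dist_sq_le_of_notMem_thickening {S : Set E} (hS : Convex ℝ S) {a y z : E} {r r' : ℝ}
    (hr' : 0 ≤ r') (ha : a ∉ thickening r' S) (hy : y ∈ S ∩ ball a r) (hz : z ∈ S ∩ ball a r) :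
    dist y z ^ 2 ≤ 4 * (r ^ 2 - r' ^ 2) := by
  have hmid : r' ≤ dist a (midpoint ℝ y z) :=
    not_lt.1 fun hlt => ha (mem_thickening_iff.2 ⟨_, hS.midpoint_mem hy.1 hz.1, hlt⟩)
  have hapollonius :=
    EuclideanGeometry.dist_sq_add_dist_sq_eq_two_mul_dist_midpoint_sq_add_half_dist_sq a y z
  have hay : dist a y ^ 2 ≤ r ^ 2 := by gcongr; exact (mem_ball'.1 hy.2).le
  have haz : dist a z ^ 2 ≤ r ^ 2 := by gcongr; exact (mem_ball'.1 hz.2).le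
  have hmid_sq : r' ^ 2 ≤ dist a (midpoint ℝ y z) ^ 2 := by gcongr
  linarith

theorem IsCollectionwiseNormal.exists_continuous_mem_thickening_of_sq_le_add
    (hX : IsCollectionwiseNormal X) {T : Set E} {d ρ : ℝ} (hT : HasUniformDiscretization T d)
    (hdρ : d < ρ) (hρ : 0 ≤ ρ) :
    ∃ η > 0, ∀ {Φ : X → Set E} {C : Set X} {r r' : ℝ}, LowerHemicontinuous Φ →
      (∀ x, Convex ℝ (Φ x)) → IsClosed C → (∀ x ∈ C, Φ x ⊆ T) → ρ ≤ r' → r ^ 2 ≤ r' ^ 2 + η →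
      (∃ g : X → E, Continuous g ∧ ∀ x ∈ C, g x ∈ thickening r (Φ x)) →
      ∃ g : X → E, Continuous g ∧ ∀ x ∈ C, g x ∈ thickening r' (Φ x) := by
  have : NormalSpace X := hX.normalSpace
  obtain ⟨θ, hθ, happrox⟩ := hX.exists_continuous_dist_lt hT hdρ
  refine ⟨(θ / 4) ^ 2, by positivity, ?_⟩
  rintro Φ C r r' hΦ hconv hC hCT hρr' hrr' ⟨g, hg, hgC⟩
  have hr' : 0 ≤ r' := hρ.trans hρr'
  let F : Set X := {x ∈ C | g x ∉ thickening r' (Φ x)}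
  have hF : IsClosed F := hC.inter (isOpen_setOf_mem_thickening hΦ hg r').isClosed_compl
  choose! p hpΦ hgp using fun x (hx : x ∈ F) => mem_thickening_iff.1 (hgC x hx.1)
  have hp_osc : OscillationLT θ p F := by
    refine oscillationLT_of_forall_dist_le (hΦ.inter_hasOpenCGraph (hasOpenCGraph_ball hg r))
      (fun x hx => ⟨hpΦ x hx, mem_ball'.2 (hgp x hx)⟩) (fun x hx y hy z hz => ?_) (half_lt_self hθ)
    have hdist_sq := dist_sq_le_of_notMem_thickening (hconv x) hr' hx.2 hy hz
    exact (sq_le_sq₀ dist_nonneg (half_pos hθ).le).1 (by linarith)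
  obtain ⟨v, hv, hvp⟩ := happrox hF hp_osc fun x hx => hCT x hx.1 (hpΦ x hx)
  obtain ⟨h, hh, -, hhC⟩ := exists_continuous_eqOn_mem (fun x => (hconv x).thickening r') hF
    (isOpen_setOf_mem_thickening hΦ hv r')
    (fun x hx => mem_thickening_iff.2 ⟨p x, hpΦ x hx, (hvp x hx).trans_le hρr'⟩) hg hv.continuousOn
    fun x hx => hx
  exact ⟨h, hh, fun x hx => hhC x fun hxF => by_contra fun hgx => hxF ⟨hx, hgx⟩⟩

theorem IsCollectionwiseNormal.exists_continuous_mem_thickening (hX : IsCollectionwiseNormal X)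
    {T : Set E} {d ρ r : ℝ} (hT : HasUniformDiscretization T d) (hdρ : d < ρ) (hρ : 0 ≤ ρ)
    {Φ : X → Set E} (hΦ : LowerHemicontinuous Φ) (hconv : ∀ x, Convex ℝ (Φ x)) {C : Set X}
    (hC : IsClosed C) (hCT : ∀ x ∈ C, Φ x ⊆ T) {g : X → E} (hg : Continuous g)
    (hgC : ∀ x ∈ C, g x ∈ thickening r (Φ x)) :
    ∃ h : X → E, Continuous h ∧ ∀ x ∈ C, h x ∈ thickening ρ (Φ x) := by
  obtain ⟨η, hη, hstep⟩ := hX.exists_continuous_mem_thickening_of_sq_le_add hT hdρ hρ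
  have hiter : ∀ j : ℕ,
      (∃ g : X → E, Continuous g ∧ ∀ x ∈ C, g x ∈ thickening √(ρ ^ 2 + j * η) (Φ x)) →
        ∃ h : X → E, Continuous h ∧ ∀ x ∈ C, h x ∈ thickening ρ (Φ x) := by
    intro j
    induction j with
    | zero => simp [Real.sqrt_sq hρ]
    | succ j ih =>
      refine fun hj => ih (hstep hΦ hconv hC hCT (Real.le_sqrt_of_sq_le ?_) ?_ hj)
      · exact le_add_of_nonneg_right (by positivity)
      · rw [Real.sq_sqrt (by positivity), Real.sq_sqrt (by positivity)]
        exact le_of_eq (by push_cast; ring)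
  obtain ⟨j, hj⟩ := exists_nat_ge (r ^ 2 / η)
  have hr : r ≤ √(ρ ^ 2 + j * η) := Real.le_sqrt_of_sq_le <| by
    linarith [(div_le_iff₀ hη).1 hj, sq_nonneg ρ]
  exact hiter j ⟨g, hg, fun x hx => thickening_mono hr _ (hgC x hx)⟩

end Improvement

section Exhaustion

variable {X : Type*} [TopologicalSpace X]

theorem exists_monotone_isClosed_between [NormalSpace X] {C U : ℕ → Set X}
    (hC : ∀ n, IsClosed (C n)) (hU : ∀ n, IsOpen (U n)) (hU_mono : Monotone U)
    (hCU : ∀ n, C n ⊆ U n) :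
    ∃ Q : ℕ → Set X, (∀ n, IsClosed (Q n)) ∧ Monotone Q ∧ (∀ n, C n ⊆ interior (Q n)) ∧
      ∀ n, Q n ⊆ U n := by
  choose P hP hCP hPU using fun n => normal_exists_closure_subset (hC n) (hU n) (hCU n)
  refine ⟨accumulate fun n => closure (P n),
    fun n => (finite_le_nat n).isClosed_biUnion fun _ _ => isClosed_closure, monotone_accumulate,
    fun n => (hCP n).trans (interior_maximal ?_ (hP n)),
    fun n => iUnion₂_subset fun m hmn => (hPU m).trans (hU_mono hmn)⟩
  exact subset_closure.trans (subset_accumulate (s := fun n => closure (P n)))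

variable {ι E : Type*} [NormedAddCommGroup E] [InnerProductSpace ℝ E]

theorem exists_monotone_isClosed_nonempty_inter_l1Ball [NormalSpace X] (b : HilbertBasis ι ℝ E)
    {Φ : X → Set E} (hΦ : LowerHemicontinuous Φ) {F : Set X} (hF : IsClosed F)
    (hne : ∀ x ∈ F, (Φ x).Nonempty) {s β : ℝ}
    (hdiam : ∀ x ∈ F, ∀ y ∈ Φ x, ∀ z ∈ Φ x, dist y z ≤ s) (hsβ : s < β) :
    ∃ Q : ℕ → Set X, (∀ n, IsClosed (Q n)) ∧ Monotone Q ∧ F ⊆ ⋃ n, interior (Q n) ∧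
      ∀ n, ∀ x ∈ Q n, (Φ x ∩ thickening β (l1Ball b n)).Nonempty := by
  obtain ⟨γ, hsγ, hγβ⟩ := exists_between hsβ
  let C : ℕ → Set X := fun n => {x ∈ F | Φ x ⊆ cthickening γ (l1Ball b n)}
  have hC : ∀ n, IsClosed (C n) := fun n =>
    hF.inter (lowerHemicontinuous_iff_isClosed_preimage_Iic.1 hΦ _ isClosed_cthickening)
  have hl1Ball_mono : Monotone fun n : ℕ => l1Ball b n := (l1Ball_mono b).comp Nat.mono_cast
  obtain ⟨Q, hQ, hQ_mono, hCQ, hQU⟩ := exists_monotone_isClosed_between hC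
    (U := fun n => {x | (Φ x ∩ thickening β (l1Ball b n)).Nonempty})
    (fun n => lowerHemicontinuous_iff_isOpen_inter_nonempty.1 hΦ _ isOpen_thickening)
    (fun m n hmn x hx => hx.mono <| inter_subset_inter_right _ <|
      thickening_subset_of_subset _ (hl1Ball_mono hmn))
    fun n x ⟨hxF, hx⟩ => (hne x hxF).mono fun y hy => by
      have hβ : 0 < β := dist_nonneg.trans_lt ((hdiam x hxF y hy y hy).trans_lt hsβ)
      exact ⟨hy, cthickening_subset_thickening' hβ hγβ _ (hx hy)⟩
  refine ⟨Q, hQ, hQ_mono, fun x hxF => ?_, hQU⟩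
  obtain ⟨a, ha⟩ := hne x hxF
  obtain ⟨n, hn⟩ := exists_nat_mem_thickening_l1Ball b a (sub_pos.2 hsγ)
  refine mem_iUnion.2 ⟨n, hCQ n ⟨hxF, fun y hy => thickening_subset_cthickening _ _ ?_⟩⟩
  obtain ⟨z, hz, haz⟩ := mem_thickening_iff.1 hn
  refine mem_thickening_iff.2 ⟨z, hz, (dist_triangle y a z).trans_lt ?_⟩
  linarith [hdiam x hxF y hy a ha]

end Exhaustion

section Selection

variable {X E : Type*} [TopologicalSpace X] [NormedAddCommGroup E] [InnerProductSpace ℝ E]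

theorem IsCollectionwiseNormal.exists_continuous_mem_thickening_of_inter_l1Ball {ι : Type*}
    (hX : IsCollectionwiseNormal X) (b : HilbertBasis ι ℝ E) {n β ρ r : ℝ} (hβ : 0 < β)
    (hβρ : 2 * β < ρ) {Φ : X → Set E} (hΦ : LowerHemicontinuous Φ) (hconv : ∀ x, Convex ℝ (Φ x))
    {g : X → E} (hg : Continuous g) (hΦg : ∀ x, Φ x ⊆ ball (g x) r) {Q : Set X} (hQ : IsClosed Q)
    (hne : ∀ x ∈ Q, (Φ x ∩ thickening β (l1Ball b n)).Nonempty) :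
    ∃ h : X → E, Continuous h ∧ ∀ x ∈ Q, h x ∈ thickening ρ (Φ x) := by
  obtain ⟨d, hβd, hdρ⟩ := exists_between hβρ
  have hg_sel : ∀ x ∈ Q, g x ∈ thickening r (Φ x ∩ thickening β (l1Ball b n)) := fun x hx => by
    obtain ⟨y, hy, hyT⟩ := hne x hx
    exact mem_thickening_iff.2 ⟨y, ⟨hy, hyT⟩, mem_ball'.1 (hΦg x hy)⟩
  obtain ⟨h, hh, hhQ⟩ := hX.exists_continuous_mem_thickening
    (hasUniformDiscretization_thickening_l1Ball b (n := n) hβ hβd) hdρ (by linarith)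
    (hΦ.inter_hasOpenCGraph (HasOpenCGraph.const isOpen_thickening))
    (fun x => (hconv x).inter ((convex_l1Ball b n).thickening β)) hQ
    (fun x _ => inter_subset_right) hg hg_sel
  exact ⟨h, hh, fun x hx => thickening_subset_of_subset _ inter_subset_left (hhQ x hx)⟩

theorem IsCollectionwiseNormal.exists_isEpsSelection_of_subset_ball [CompleteSpace E]
    (hX : IsCollectionwiseNormal X) {Φ : X → Set E} (hΦ : LowerHemicontinuous Φ)
    (hconv : ∀ x, Convex ℝ (Φ x)) (hne : ∀ x, (Φ x).Nonempty) {g : X → E} (hg : Continuous g)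
    {r : ℝ} (hr : 0 < r) (hΦg : ∀ x, Φ x ⊆ ball (g x) r) :
    ∃ h : X → E, Continuous h ∧ IsEpsSelection (99 / 100 * r) h Φ := by
  have : NormalSpace X := hX.normalSpace
  obtain ⟨_, b, -⟩ := exists_hilbertBasis ℝ E
  set ρ := 99 / 100 * r with hρ
  have hK : ∀ x, Convex ℝ (thickening ρ (Φ x)) := fun x => (hconv x).thickening ρ
  let F : Set X := {x | g x ∉ thickening ρ (Φ x)}
  have hF : IsClosed F := (isOpen_setOf_mem_thickening hΦ hg ρ).isClosed_compl
  have hdiam : ∀ x ∈ F, ∀ y ∈ Φ x, ∀ z ∈ Φ x, dist y z ≤ 3 / 10 * r := fun x hx y hy z hz => by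
    have hdist_sq := dist_sq_le_of_notMem_thickening (hconv x) (by positivity) hx
      ⟨hy, hΦg x hy⟩ ⟨hz, hΦg x hz⟩
    refine (sq_le_sq₀ dist_nonneg (by positivity)).1 (hdist_sq.trans ?_)
    rw [hρ]
    nlinarith
  obtain ⟨Q, hQ, hQ_mono, hFQ, hQ_ne⟩ := exists_monotone_isClosed_nonempty_inter_l1Ball b hΦ hF
    (fun x _ => hne x) hdiam (show 3 / 10 * r < 2 / 5 * r by linarith)
  obtain ⟨v, hv, hvK⟩ := exists_continuousOn_iUnion_mem (hasOpenCGraph_thickening hΦ ρ) hK hQ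
    hQ_mono fun n => hX.exists_continuous_mem_thickening_of_inter_l1Ball b (by positivity)
      (by linarith) hΦ hconv hg hΦg (hQ n) (hQ_ne n)
  obtain ⟨h, hh, -, hhK⟩ := exists_continuous_eqOn_mem hK hF
    (isOpen_iUnion fun n => isOpen_interior) hFQ hg hv
    fun x hx => hvK x (iUnion_mono (fun n => interior_subset) hx)
  exact ⟨h, hh, fun x => hhK x fun hx => not_not.1 hx⟩

theorem IsCollectionwiseNormal.exists_isEpsSelection_dist_lt [CompleteSpace E]
    (hX : IsCollectionwiseNormal X) {Φ : X → Set E} (hΦ : LowerHemicontinuous Φ)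
    (hconv : ∀ x, Convex ℝ (Φ x)) {g : X → E} (hg : Continuous g) {r : ℝ} (hr : 0 < r)
    (hgr : IsEpsSelection r g Φ) :
    ∃ h : X → E, Continuous h ∧ IsEpsSelection (99 / 100 * r) h Φ ∧
      ∀ x, dist (g x) (h x) < 2 * r := by
  have hne : ∀ x, (Φ x ∩ ball (g x) r).Nonempty := fun x =>
    (mem_thickening_iff.1 (hgr x)).imp fun y hy => ⟨hy.1, mem_ball'.2 hy.2⟩
  obtain ⟨h, hh, hhΦ⟩ := hX.exists_isEpsSelection_of_subset_ball
    (hΦ.inter_hasOpenCGraph (hasOpenCGraph_ball hg r))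
    (fun x => (hconv x).inter (convex_ball _ _)) hne hg hr fun x => inter_subset_right
  refine ⟨h, hh, fun x => thickening_subset_of_subset _ inter_subset_left (hhΦ x), fun x => ?_⟩
  obtain ⟨y, ⟨-, hy⟩, hhy⟩ := mem_thickening_iff.1 (hhΦ x)
  rw [dist_comm] at hhy
  linarith [dist_triangle (g x) y (h x), mem_ball'.1 hy]

end Selection

section Limit

variable {X E : Type*} [PseudoMetricSpace E]

theorem isSelection_of_tendsto_isEpsSelection {Φ : X → Set E} (hcl : ∀ x, IsClosed (Φ x))
    {F : ℕ → X → E} {f : X → E} {δ : ℕ → ℝ} (hδ : Tendsto δ atTop (𝓝 0))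
    (hF : ∀ n, IsEpsSelection (δ n) (F n) Φ) (hf : ∀ x, Tendsto (F · x) atTop (𝓝 (f x))) :
    IsSelection f Φ := fun x => by
  choose y hyΦ hFy using fun n => mem_thickening_iff.1 (hF n x)
  have hy : Tendsto y atTop (𝓝 (f x)) :=
    (hf x).congr_dist (squeeze_zero (fun _ => dist_nonneg) (fun n => (hFy n).le) hδ)
  exact (hcl x).mem_of_tendsto hy (Eventually.of_forall hyΦ)

variable [CompleteSpace E]

theorem exists_tendstoUniformly_of_dist_le_geometric {F : ℕ → X → E} {C c : ℝ} (hc0 : 0 ≤ c)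
    (hc : c < 1) (hF : ∀ n x, dist (F n x) (F (n + 1) x) ≤ C * c ^ n) :
    ∃ f : X → E, TendstoUniformly F f atTop := by
  choose f hf using fun x =>
    cauchySeq_tendsto_of_complete (cauchySeq_of_le_geometric c C hc fun n => hF n x)
  refine ⟨f, Metric.tendstoUniformly_iff.2 fun δ hδ => ?_⟩
  have htail : Tendsto (fun n => C * c ^ n / (1 - c)) atTop (𝓝 0) := by
    simpa using ((tendsto_pow_atTop_nhds_zero_of_lt_one hc0 hc).const_mul C).div_const (1 - c)
  filter_upwards [htail.eventually_lt_const hδ] with n hn x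
  rw [dist_comm]
  exact (dist_le_of_le_geometric_of_tendsto c C hc (fun n => hF n x) (hf x) n).trans_lt hn

theorem exists_isSelection_of_forall_exists_isEpsSelection [TopologicalSpace X] {Φ : X → Set E}
    (hcl : ∀ x, IsClosed (Φ x)) {c L : ℝ} (hc0 : 0 < c) (hc : c < 1)
    (himprove : ∀ r > 0, ∀ g : X → E, Continuous g → IsEpsSelection r g Φ →
      ∃ h : X → E, Continuous h ∧ IsEpsSelection (c * r) h Φ ∧ ∀ x, dist (g x) (h x) ≤ L * r)
    {ε : ℝ} (hε : 0 < ε) {g : X → E} (hg : Continuous g) (hgε : IsEpsSelection ε g Φ) :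
    ∃ f : X → E, Continuous f ∧ IsSelection f Φ := by
  choose next hnext_cont hnext_sel hnext_dist using
    fun n (g : {g : X → E // Continuous g ∧ IsEpsSelection (c ^ n * ε) g Φ}) =>
      himprove (c ^ n * ε) (by positivity) g g.2.1 g.2.2
  let G : ∀ n, {g : X → E // Continuous g ∧ IsEpsSelection (c ^ n * ε) g Φ} := fun n =>
    Nat.rec ⟨g, hg, by simpa using hgε⟩
      (fun n g => ⟨next n g, hnext_cont n g, by
        rw [pow_succ', mul_assoc]
        exact hnext_sel n g⟩) n
  obtain ⟨f, hf⟩ := exists_tendstoUniformly_of_dist_le_geometric (F := fun n => (G n).1)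
    (C := L * ε) hc0.le hc fun n x => (hnext_dist n (G n) x).trans_eq (by ring)
  refine ⟨f, hf.continuous (Frequently.of_forall fun n => (G n).2.1), ?_⟩
  refine isSelection_of_tendsto_isEpsSelection hcl ?_ (fun n => (G n).2.2) hf.tendsto_at
  simpa using (tendsto_pow_atTop_nhds_zero_of_lt_one hc0.le hc).mul_const ε

end Limit

theorem mainTheorem3_general {X E : Type*} [TopologicalSpace X] [NormedAddCommGroup E]
    [InnerProductSpace ℝ E] [CompleteSpace E] (hX : IsCollectionwiseNormal X) {Φ : X → Set E}
    (hconv : ∀ x, Convex ℝ (Φ x)) (hcl : ∀ x, IsClosed (Φ x)) (hlsc : LowerHemicontinuous Φ)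
    {ε : ℝ} (hε : 0 < ε) {g : X → E} (hg : Continuous g) (hgε : IsEpsSelection ε g Φ) :
    ∃ f : X → E, Continuous f ∧ IsSelection f Φ := by
  refine exists_isSelection_of_forall_exists_isEpsSelection hcl (c := 99 / 100) (L := 2)
    (by norm_num) (by norm_num) (fun r hr g hg hgr => ?_) hε hg hgε
  obtain ⟨h, hh, hhΦ, hgh⟩ := hX.exists_isEpsSelection_dist_lt hlsc hconv hg hr hgr
  exact ⟨h, hh, hhΦ, fun x => (hgh x).le⟩

theorem mainTheorem3 {X E : Type*} [TopologicalSpace X] [T2Space X]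
    [NormedAddCommGroup E] [InnerProductSpace ℝ E] [CompleteSpace E]
    (hX : IsCollectionwiseNormal X)
    (Φ : X → Set E) (hΦ : ∀ x, Φ x ∈ closedConvexSets E) (hlsc : LowerHemicontinuous Φ)
    (hε : ∃ ε : ℝ, 0 < ε ∧ ∃ g : X → E, Continuous g ∧ IsEpsSelection ε g Φ) :
    ∃ f : X → E, Continuous f ∧ IsSelection f Φ := by
  obtain ⟨ε, hε, g, hg, hgε⟩ := hε
  exact mainTheorem3_general hX (fun x => (hΦ x).2.2) (fun x => (hΦ x).2.1) hlsc hε hg hgε
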